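/- Let $a_n$ ($n=0,1,2,\dots$) be the Taylor coefficients at $0$ of the entire function $1/\Gamma(z)=\sum_{n\ge 0}a_nz^n$ (so $a_0=0$), and let $W_0$ be the principal real branch of the Lambert function, i.e. for $x\ge -1/e$, $W_0(x)$ is the unique real $w\ge -1$ with $we^w=x$. For $n\ge 0$ and $R>0$ put $B_n(R)=e^{\pi R/2}R^{1/2+R-n}$. (1) For every integer $n\ge 0$ and every real $R>0$, $|a_n|\le B_n(R)=e^{\pi R/2}R^{1/2+R-n}$. (2) For every integer $n\ge 1$, the number $R=\dfrac{n-\frac12}{W_0\left((n+\frac12)e^{\pi/2+1}\right)}$ is positive and $|a_n|\le e^{\pi R/2}R^{1/2+R-n}$. (3) For every integer $n\ge 1$, the number $R_n=\dfrac{n-\frac12}{W_0\left((n-\frac12)e^{\pi/2+1}\right)}$ is positive, $|a_n|\le B_n(R_n)$, and $R_n$ is the optimal choice of the radius: $B_n(R_n)<B_n(R)$ for every $R>0$ with $R\ne R_n$. -/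

import Mathlib

/-- The `n`-th Taylor coefficient at `0` of the entire function `1 / Γ(z)`. Mathlib gives `Γ` the
value `0` at its poles, so `(Complex.Gamma z)⁻¹` takes the correct value `0` there. -/
noncomputable def rgammaCoeff (n : ℕ) : ℂ :=
  iteratedDeriv n (fun z : ℂ => (Complex.Gamma z)⁻¹) 0 / (n.factorial : ℂ)

/-- The principal real branch `W₀` of the Lambert function: for `x ≥ -1/e`, the unique `w ≥ -1` with
`w * exp w = x` (see `lambertW0_spec` and `lambertW0_unique`); irrelevant values for `x < -1/e`. -/
noncomputable def lambertW0 : ℝ → ℝ :=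
  Function.invFunOn (fun w : ℝ => w * Real.exp w) (Set.Ici (-1))

theorem strictMonoOn_mul_exp : StrictMonoOn (fun w : ℝ => w * Real.exp w) (Set.Ici (-1)) := by
  apply strictMonoOn_of_deriv_pos (convex_Ici _) (by fun_prop)
  intro x hx
  rw [interior_Ici, Set.mem_Ioi] at hx
  have h : HasDerivAt (fun w : ℝ => w * Real.exp w) (1 * Real.exp x + x * Real.exp x) x :=
    (hasDerivAt_id x).mul (Real.hasDerivAt_exp x)
  rw [h.deriv]
  have := mul_pos (by linarith : 0 < 1 + x) (Real.exp_pos x)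
  linarith

theorem lambertW0_spec {x : ℝ} (hx : -Real.exp (-1) ≤ x) :
    -1 ≤ lambertW0 x ∧ lambertW0 x * Real.exp (lambertW0 x) = x := by
  have hex : ∃ w ∈ Set.Ici (-1 : ℝ), w * Real.exp w = x := by
    have hc : ContinuousOn (fun w : ℝ => w * Real.exp w) (Set.Icc (-1) |x|) := by fun_prop
    have h0 := abs_nonneg x
    have h1 : x ≤ |x| * Real.exp |x| :=
      (le_abs_self x).trans (le_mul_of_one_le_right h0 (Real.one_le_exp h0))
    obtain ⟨w, hw, e⟩ := intermediate_value_Icc (by linarith : (-1 : ℝ) ≤ |x|) hc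
      (show x ∈ _ from ⟨by simpa using hx, h1⟩)
    exact ⟨w, hw.1, e⟩
  exact ⟨Function.invFunOn_mem hex, Function.invFunOn_eq hex⟩

theorem lambertW0_unique {w : ℝ} (hw : -1 ≤ w) : lambertW0 (w * Real.exp w) = w := by
  have hx : -Real.exp (-1) ≤ w * Real.exp w := by
    have h := strictMonoOn_mul_exp.monotoneOn (Set.mem_Ici.2 le_rfl) (Set.mem_Ici.2 hw) hw
    simpa using h
  exact strictMonoOn_mul_exp.injOn (lambertW0_spec hx).1 hw (lambertW0_spec hx).2

/-- The function `e^{πR/2} R^{1/2 + R - n}` of `R > 0` that bounds the `n`-th coefficient. -/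
noncomputable def coeffBound (n : ℕ) (R : ℝ) : ℝ :=
  Real.exp (Real.pi * R / 2) * R ^ ((1 : ℝ) / 2 + R - (n : ℝ))

/-- The radius `(n - 1/2) / W₀((n + 1/2) e^{π/2 + 1})`. -/
noncomputable def shiftedRadius (n : ℕ) : ℝ :=
  ((n : ℝ) - 1 / 2) / lambertW0 (((n : ℝ) + 1 / 2) * Real.exp (Real.pi / 2 + 1))

/-- The radius `(n - 1/2) / W₀((n - 1/2) e^{π/2 + 1})`, the critical point of `coeffBound n`. -/
noncomputable def optimalRadius (n : ℕ) : ℝ :=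
  ((n : ℝ) - 1 / 2) / lambertW0 (((n : ℝ) - 1 / 2) * Real.exp (Real.pi / 2 + 1))

/-!
The bound is Cauchy's estimate on the circle `‖z‖ = R` for `1 / Γ(z) = z / Γ(1 + z)`, so everything
rests on upper bounds for `1 / |Γ(1 + z)|` there.

On the half-plane `0 ≤ Re z`, Euler's beta integral `B(x, 1 + iy) = Γ(x) Γ(1 + iy) / Γ(1 + x + iy)`
has modulus at most `B(x, 1) = 1 / x`, which gives `|Γ(1 + iy)| Γ(1 + x) ≤ |Γ(1 + x + iy)|`
(`norm_Gamma_one_add_im_mul_le`). The reflection formula gives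
`|Γ(1 + iy)|⁻² = sinh (π y) / (π y)`, and this is at most `e^{πY} / (2πY)` for `|y| ≤ Y`
(`inv_normSq_Gamma_one_add_im_le`); log-convexity gives `Γ(1 + x) ≥ 2 / 3`. On the other half-plane
the functional equation moves `z` to `z + j + 1` with real part in `[0, 1)`, and every factor except
the last one has modulus at most `‖z‖` (`exists_shift_of_re_neg`). If `1 ≤ R`, comparing
exponents then yields `1 / |Γ(1 + z)| ≤ e^{πR/2} R^{R - 1/2}` on the circle
(`normSq_inv_Gamma_one_add_le_of_one_le_norm`), which is exactly what Cauchy's estimate needs.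

For `R ≤ 1` the same circle is not needed: the coefficients of index `0` and `1` are `0` and `1`,
and for `n ≥ 2` the unit circle gives the constant bound `3.38`, which stays below
`e^{πR/2} R^{1/2 + R - n}` for all such `R` (`le_coeffBound_of_le_one`).

For the optimal radius, put `ν = n - 1/2`. The defining equation of `W₀` says that
`p = optimalRadius n` satisfies `log p + π/2 + 1 = ν / p`. Replacing `R log R` and `-ν log R` in
`log (coeffBound n R) = πR/2 + R log R - ν log R` by their tangent lines at `p` leaves the constant
`log (coeffBound n p)`, and the second replacement is strict for `R ≠ p`.
-/

/-! ### Lower bounds for the gamma function on the right half-plane -/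

open Real in
/-- The modulus of `B(x, 1 + iy)` is at most `B(x, 1) = 1 / x`; the case `x = 0` is trivial. -/
theorem norm_Gamma_one_add_im_mul_le {x : ℝ} (hx : 0 ≤ x) (y : ℝ) :
    ‖Complex.Gamma (1 + y * Complex.I)‖ * Real.Gamma (1 + x) ≤
      ‖Complex.Gamma (1 + (x + y * Complex.I))‖ := by
  rcases hx.eq_or_lt with rfl | hx
  · simp
  have hB : ‖Complex.betaIntegral x (1 + y * Complex.I)‖ ≤ 1 / x := by
    have hint : ∫ u : ℝ in 0..1, u ^ (x - 1) = 1 / x := by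
      rw [integral_rpow (Or.inl (by linarith)), sub_add_cancel, one_rpow, zero_rpow hx.ne', sub_zero]
    rw [← hint]
    refine intervalIntegral.norm_integral_le_of_norm_le zero_le_one
      (Filter.Eventually.of_forall fun u hu => ?_)
      (intervalIntegral.intervalIntegrable_rpow' (by linarith))
    rw [norm_mul, Complex.norm_cpow_eq_rpow_re_of_pos hu.1]
    refine mul_le_of_le_one_right (rpow_nonneg hu.1.le _) ?_ |>.trans_eq (by simp)
    -- At `u = 1` the base vanishes, and `0 ^ (iy)` is `0` or `1` according to the convention.
    rcases hu.2.eq_or_lt with rfl | h1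
    · by_cases hy : y = 0
      · simp [hy]
      · rw [Complex.ofReal_one, sub_self, Complex.zero_cpow (by simpa using hy)]
        simp
    · rw [← Complex.ofReal_one, ← Complex.ofReal_sub,
        Complex.norm_cpow_eq_rpow_re_of_pos (by linarith)]
      simp
  have h := congrArg norm (Complex.Gamma_mul_Gamma_eq_betaIntegral (s := x)
    (t := 1 + y * Complex.I) (by simpa) (by simp))
  rw [norm_mul, norm_mul, Complex.Gamma_ofReal, Complex.norm_real,
    Real.norm_of_nonneg (Gamma_pos_of_pos hx).le,
    show (x : ℂ) + (1 + y * Complex.I) = 1 + (x + y * Complex.I) by ring] at h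
  rw [add_comm 1 x, Gamma_add_one hx.ne']
  calc ‖Complex.Gamma (1 + y * Complex.I)‖ * (x * Gamma x)
      = x * (Gamma x * ‖Complex.Gamma (1 + y * Complex.I)‖) := by ring
    _ ≤ x * (‖Complex.Gamma (1 + (x + y * Complex.I))‖ * (1 / x)) := by
        rw [h]; gcongr
    _ = _ := by field_simp

/-- Euler's reflection formula at `iy`, multiplied by `iy`. -/
theorem normSq_Gamma_one_add_im {y : ℝ} (hy : y ≠ 0) :
    ‖Complex.Gamma (1 + y * Complex.I)‖ ^ 2 = Real.pi * y / Real.sinh (Real.pi * y) := by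
  have hyI : (y : ℂ) * Complex.I ≠ 0 := by simpa using hy
  have hrefl := Complex.Gamma_mul_Gamma_one_sub (y * Complex.I)
  have hconj : (starRingEnd ℂ) (1 + y * Complex.I) = 1 - y * Complex.I := by
    simp [sub_eq_add_neg]
  have h : Complex.Gamma (1 + y * Complex.I) * Complex.Gamma (1 - y * Complex.I) =
      ((Real.pi * y / Real.sinh (Real.pi * y) : ℝ) : ℂ) := by
    have hs : (Real.sinh (Real.pi * y) : ℂ) ≠ 0 := by
      rw [Complex.ofReal_ne_zero, Ne, Real.sinh_eq_zero]
      exact mul_ne_zero Real.pi_ne_zero hy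
    rw [add_comm, Complex.Gamma_add_one _ hyI, mul_assoc, hrefl, ← mul_assoc, ← Complex.ofReal_mul,
      Complex.sin_mul_I, ← Complex.ofReal_sinh, Complex.ofReal_div, Complex.ofReal_mul]
    field_simp
  rw [← hconj, Complex.Gamma_conj, Complex.mul_conj, Complex.ofReal_inj] at h
  rw [← h, Complex.normSq_eq_norm_sq]

theorem convexOn_sinh : ConvexOn ℝ (Set.Ici 0) Real.sinh := by
  refine MonotoneOn.convexOn_of_deriv (convex_Ici 0) Real.continuous_sinh.continuousOn
    Real.differentiable_sinh.differentiableOn ?_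
  rw [Real.deriv_sinh, interior_Ici]
  intro a ha b hb hab
  rw [Set.mem_Ioi] at ha hb
  rwa [Real.cosh_le_cosh, abs_of_pos ha, abs_of_pos hb]

/-- The function `sinh t / t` is increasing on `t > 0` by convexity of `sinh`, so the left side is at
most its value at `Y`. -/
theorem inv_normSq_Gamma_one_add_im_le {y Y : ℝ} (hY : 0 < Y) (hyY : |y| ≤ Y) :
    (‖Complex.Gamma (1 + y * Complex.I)‖ ^ 2)⁻¹ ≤
      Real.exp (Real.pi * Y) / (2 * (Real.pi * Y)) := by
  have hπ := Real.pi_pos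
  rcases eq_or_ne y 0 with rfl | hy
  · rw [le_div_iff₀ (by positivity)]
    have h1 := Real.add_one_le_exp (Real.pi * Y - 1)
    have h2 : Real.exp (Real.pi * Y) = Real.exp 1 * Real.exp (Real.pi * Y - 1) := by
      rw [← Real.exp_add]; ring_nf
    have h3 := Real.exp_one_gt_two
    have h4 : 0 < Real.pi * Y := by positivity
    simp
    nlinarith
  · rw [normSq_Gamma_one_add_im hy, inv_div]
    have habs : Real.sinh (Real.pi * y) / (Real.pi * y) =
        Real.sinh (Real.pi * |y|) / (Real.pi * |y|) := by
      rcases abs_choice y with h | h <;> rw [h]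
      rw [mul_neg, Real.sinh_neg, neg_div_neg_eq]
    have hy' : 0 < |y| := abs_pos.2 hy
    -- The chord of `sinh` from `0` to `π Y` lies above the graph at `π |y|`.
    have hsec : Real.sinh (Real.pi * |y|) ≤ |y| / Y * Real.sinh (Real.pi * Y) := by
      have h := convexOn_sinh.2 (Set.mem_Ici.2 (show 0 ≤ Real.pi * Y by positivity))
        (Set.mem_Ici.2 le_rfl) (show 0 ≤ |y| / Y by positivity)
        (show 0 ≤ 1 - |y| / Y by rw [sub_nonneg, div_le_one hY]; exact hyY) (by ring)
      simp only [smul_eq_mul, mul_zero, add_zero, Real.sinh_zero] at h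
      rwa [show |y| / Y * (Real.pi * Y) = Real.pi * |y| by field_simp] at h
    have hexp : Real.sinh (Real.pi * Y) ≤ Real.exp (Real.pi * Y) / 2 := by
      rw [Real.sinh_eq]
      have := Real.exp_pos (-(Real.pi * Y))
      linarith
    rw [habs, div_le_iff₀ (by positivity)]
    calc _ ≤ |y| / Y * (Real.exp (Real.pi * Y) / 2) := hsec.trans (by gcongr)
      _ = _ := by field_simp

/-- Log-convexity at the midpoint `2` of `1 + t` and `3 - t`, with the chord bound
`Γ(3 - t) ≤ 2 - t` between `2` and `3`. -/
theorem Gamma_one_add_ge_inv {t : ℝ} (h0 : 0 ≤ t) (h1 : t ≤ 1) :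
    1 / (2 - t) ≤ Real.Gamma (1 + t) := by
  have hG3 : Real.Gamma 3 = 2 := by
    rw [show (3 : ℝ) = 2 + 1 by norm_num, Real.Gamma_add_one (by norm_num), Real.Gamma_two]
    norm_num
  have hup : Real.Gamma (3 - t) ≤ 2 - t := by
    have h := Real.convexOn_Gamma.2 (show (2 : ℝ) ∈ Set.Ioi 0 by simp)
      (show (3 : ℝ) ∈ Set.Ioi 0 by simp) h0 (sub_nonneg.2 h1)
      (by ring)
    simp only [smul_eq_mul, Real.Gamma_two, hG3] at h
    rw [show t * 2 + (1 - t) * 3 = 3 - t by ring] at h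
    linarith
  have hpos : 0 < Real.Gamma (1 + t) := Real.Gamma_pos_of_pos (by linarith)
  have hpos' : 0 < Real.Gamma (3 - t) := Real.Gamma_pos_of_pos (by linarith)
  have hmid := Real.Gamma_mul_add_mul_le_rpow_Gamma_mul_rpow_Gamma (s := 1 + t) (t := 3 - t)
    (a := 1 / 2) (b := 1 / 2) (by linarith) (by linarith) (by norm_num) (by norm_num) (by norm_num)
  rw [show (1 : ℝ) / 2 * (1 + t) + 1 / 2 * (3 - t) = 2 by ring, Real.Gamma_two,
    ← Real.mul_rpow hpos.le hpos'.le, ← Real.sqrt_eq_rpow, Real.one_le_sqrt] at hmid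
  rw [div_le_iff₀ (by linarith)]
  exact hmid.trans (by gcongr)

theorem two_thirds_le_Gamma_one_add {t : ℝ} (h0 : 0 ≤ t) : 2 / 3 ≤ Real.Gamma (1 + t) := by
  have hmono : ∀ s : ℝ, 2 ≤ s → 1 ≤ Real.Gamma s := fun s hs =>
    Real.Gamma_two ▸ Real.Gamma_strictMonoOn_Ici.monotoneOn (Set.mem_Ici.2 le_rfl) hs hs
  rcases le_total t (1 / 2) with h | h
  · have h2 := hmono (1 + t + 1) (by linarith)
    rw [Real.Gamma_add_one (by linarith)] at h2
    have hpos : 0 < Real.Gamma (1 + t) := Real.Gamma_pos_of_pos (by linarith)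
    nlinarith
  · rcases le_total t 1 with h' | h'
    · refine le_trans ?_ (Gamma_one_add_ge_inv h0 h')
      rw [div_le_div_iff₀ (by norm_num) (by linarith)]
      linarith
    · linarith [hmono (1 + t) (by linarith)]

/-- The bound on the right half-plane, with a free lower bound `c` for the real gamma value. -/
theorem normSq_inv_Gamma_one_add_le {w : ℂ} {c Y : ℝ} (hw : 0 ≤ w.re) (hY : 0 < Y)
    (him : |w.im| ≤ Y) (hc : 0 < c) (hG : c ≤ Real.Gamma (1 + w.re)) :
    ‖(Complex.Gamma (1 + w))⁻¹‖ ^ 2 ≤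
      (c ^ 2)⁻¹ * (Real.exp (Real.pi * Y) / (2 * (Real.pi * Y))) := by
  have h := norm_Gamma_one_add_im_mul_le hw w.im
  rw [Complex.re_add_im] at h
  have hne : 0 < ‖Complex.Gamma (1 + w.im * Complex.I)‖ :=
    norm_pos_iff.2 (Complex.Gamma_ne_zero_of_re_pos (by simp))
  rw [norm_inv, inv_pow]
  calc (‖Complex.Gamma (1 + w)‖ ^ 2)⁻¹
      ≤ ((‖Complex.Gamma (1 + w.im * Complex.I)‖ * c) ^ 2)⁻¹ := by
        gcongr
        exact (by gcongr : _ ≤ _).trans h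
    _ = (c ^ 2)⁻¹ * (‖Complex.Gamma (1 + w.im * Complex.I)‖ ^ 2)⁻¹ := by
        rw [mul_pow, mul_inv, mul_comm]
    _ ≤ _ := by gcongr; exact inv_normSq_Gamma_one_add_im_le hY him

/-! ### Shifting from the left half-plane -/

/-- The functional equation applied `j` times, with each of the factors `z + 1, …, z + j` bounded
by `R`. -/
theorem norm_inv_Gamma_one_add_le_pow {z : ℂ} {R : ℝ} (j : ℕ)
    (hz : ∀ k : ℕ, 1 ≤ k → k ≤ j → ‖z + k‖ ≤ R) :
    ‖(Complex.Gamma (1 + z))⁻¹‖ ≤ R ^ j * ‖(Complex.Gamma (1 + (z + j)))⁻¹‖ := by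
  induction j with
  | zero => simp
  | succ j ih =>
    have hk := hz (j + 1) (by omega) le_rfl
    have hR : 0 ≤ R := (norm_nonneg _).trans hk
    refine (ih fun k h1 h2 => hz k h1 (by omega)).trans ?_
    rw [Complex.one_div_Gamma_eq_self_mul_one_div_Gamma_add_one, norm_mul, pow_succ, mul_assoc,
      show 1 + (z + (j : ℂ)) = z + (j + 1 : ℕ) by push_cast; ring,
      show z + ((j + 1 : ℕ) : ℂ) + 1 = 1 + (z + (j + 1 : ℕ)) by ring]
    gcongr

/-- With `j = ⌈-Re z⌉ - 1`, the point `z + j + 1` is the first translate in the closed right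
half-plane, and for `k ≤ j < -Re z` the identity `‖z + k‖² = ‖z‖² - k (2 (-Re z) - k)` shows that
the earlier translates do not leave the disc. -/
theorem exists_shift_of_re_neg {z : ℂ} (hz : z.re < 0) :
    ∃ j : ℕ, (j : ℝ) < -z.re ∧ 0 ≤ z.re + j + 1 ∧ ∀ k : ℕ, k ≤ j → ‖z + k‖ ≤ ‖z‖ := by
  obtain ⟨j, hj⟩ : ∃ j : ℕ, ⌈-z.re⌉₊ = j + 1 :=
    Nat.exists_eq_add_one_of_ne_zero (Nat.ceil_pos.2 (by linarith)).ne'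
  have hlt : (j : ℝ) < -z.re := Nat.lt_ceil.1 (by omega)
  have hle : -z.re ≤ j + 1 := by exact_mod_cast hj ▸ Nat.le_ceil (-z.re)
  refine ⟨j, hlt, by linarith, fun k hk => ?_⟩
  have hk' : (k : ℝ) ≤ j := by exact_mod_cast hk
  rw [← sq_le_sq₀ (norm_nonneg _) (norm_nonneg _), ← Complex.normSq_eq_norm_sq,
    ← Complex.normSq_eq_norm_sq, Complex.normSq_apply, Complex.normSq_apply]
  simp only [Complex.add_re, Complex.natCast_re, Complex.add_im, Complex.natCast_im, add_zero]
  nlinarith [(Nat.cast_nonneg k : (0 : ℝ) ≤ k)]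

/-- The translates up to `z + j` contribute `‖z‖ ^ j`; the factor `z + j + 1` is kept exactly,
because its modulus can exceed `‖z‖`. -/
theorem normSq_inv_Gamma_one_add_le_of_shift {z : ℂ} {c Y : ℝ} {j : ℕ}
    (hj : 0 ≤ z.re + j + 1) (hz : ∀ k : ℕ, k ≤ j → ‖z + k‖ ≤ ‖z‖) (hY : 0 < Y)
    (him : |z.im| ≤ Y) (hc : 0 < c) (hG : c ≤ Real.Gamma (1 + (z.re + j + 1))) :
    ‖(Complex.Gamma (1 + z))⁻¹‖ ^ 2 ≤ (‖z‖ ^ 2) ^ j * ((z.re + j + 1) ^ 2 + z.im ^ 2) *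
      ((c ^ 2)⁻¹ * (Real.exp (Real.pi * Y) / (2 * (Real.pi * Y)))) := by
  have h1 := norm_inv_Gamma_one_add_le_pow j fun k _ hk => hz k hk
  have h2 := normSq_inv_Gamma_one_add_le (w := z + j + 1) (by simpa using hj) hY
    (by simpa using him) hc (by simpa using hG)
  have h3 : ‖z + j + 1‖ ^ 2 = (z.re + j + 1) ^ 2 + z.im ^ 2 := by
    rw [← Complex.normSq_eq_norm_sq, Complex.normSq_apply]
    simp; ring
  rw [Complex.one_div_Gamma_eq_self_mul_one_div_Gamma_add_one (1 + (z + j)), norm_mul,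
    show 1 + (z + (j : ℂ)) = z + j + 1 by ring,
    show z + (j : ℂ) + 1 + 1 = 1 + (z + j + 1) by ring] at h1
  calc _ ≤ (‖z‖ ^ j * (‖z + j + 1‖ * ‖(Complex.Gamma (1 + (z + j + 1)))⁻¹‖)) ^ 2 := by gcongr
    _ = (‖z‖ ^ 2) ^ j * ‖z + j + 1‖ ^ 2 * ‖(Complex.Gamma (1 + (z + j + 1)))⁻¹‖ ^ 2 := by ring
    _ ≤ _ := by rw [h3]; gcongr

/-! ### The reciprocal gamma function on circles -/

theorem exp_pi_le : Real.exp Real.pi ≤ 28 := by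
  have h1 := Real.exp_one_lt_d9
  have hπ := Real.pi_lt_d2
  have h2 : Real.exp 0.15 ≤ 1.2 := by
    have := Real.add_one_le_exp (-0.15 : ℝ)
    rw [Real.exp_neg] at this
    have hp := Real.exp_pos 0.15
    have := (le_inv_comm₀ (by norm_num) hp).1 this
    exact this.trans (by norm_num)
  calc Real.exp Real.pi ≤ Real.exp (1 + 1 + 1 + 0.15) := Real.exp_le_exp.2 (by linarith)
    _ = Real.exp 1 * Real.exp 1 * Real.exp 1 * Real.exp 0.15 := by simp only [Real.exp_add]
    _ ≤ 2.7182818286 * 2.7182818286 * 2.7182818286 * 1.2 := by gcongr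
    _ ≤ 28 := by norm_num

theorem normSq_inv_Gamma_one_add_le_of_norm_eq_one {z : ℂ} (hz : ‖z‖ = 1) :
    ‖(Complex.Gamma (1 + z))⁻¹‖ ^ 2 ≤ 10.9 := by
  have hπ := Real.pi_gt_d2
  have hE : Real.exp (Real.pi * 1) / (2 * (Real.pi * 1)) ≤ 4.5 := by
    rw [mul_one, div_le_iff₀ (by positivity)]
    linarith [exp_pi_le]
  have him : |z.im| ≤ 1 := hz ▸ Complex.abs_im_le_norm z
  rcases le_or_gt 0 z.re with hx | hx
  · refine (normSq_inv_Gamma_one_add_le hx one_pos him (by norm_num)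
      (two_thirds_le_Gamma_one_add hx)).trans ?_
    calc _ ≤ (((2 : ℝ) / 3) ^ 2)⁻¹ * 4.5 := by gcongr
      _ ≤ _ := by norm_num
  · have hre : -1 ≤ z.re := by
      have := (abs_le.1 (hz ▸ Complex.abs_re_le_norm z)).1
      exact this
    have hsq : z.re ^ 2 + z.im ^ 2 = 1 := by
      have : ‖z‖ ^ 2 = 1 := by rw [hz, one_pow]
      rw [← Complex.normSq_eq_norm_sq, Complex.normSq_apply] at this
      linarith
    have hG := Gamma_one_add_ge_inv (t := z.re + 1) (by linarith) (by linarith)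
    have hc : 0 < 1 / (2 - (z.re + 1)) := div_pos one_pos (by linarith)
    have h := normSq_inv_Gamma_one_add_le_of_shift (z := z) (j := 0) (by simpa using by linarith)
      (fun k hk => by simp [Nat.le_zero.1 hk]) one_pos him hc (by simpa using hG)
    refine h.trans ?_
    -- On the unit circle the left side is `2 (1 - s) (1 + s) ^ 2` with `s = -Re z`, which is largest
    -- at `s = 1 / 3`.
    have h3 : ((z.re + 1) ^ 2 + z.im ^ 2) * (1 - z.re) ^ 2 ≤ 64 / 27 := by
      have h4 : (z.re + 1) ^ 2 + z.im ^ 2 = 2 + 2 * z.re := by linarith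
      rw [h4]
      nlinarith [mul_nonneg (sq_nonneg (3 * z.re + 1)) (by linarith : 0 ≤ 5 / 3 - z.re)]
    calc _ = ((z.re + 1) ^ 2 + z.im ^ 2) * (1 - z.re) ^ 2 *
          (Real.exp (Real.pi * 1) / (2 * (Real.pi * 1))) := by
          rw [one_div, inv_pow, inv_inv]
          simp only [pow_zero, Nat.cast_zero]
          ring
      _ ≤ 64 / 27 * 4.5 := by gcongr
      _ ≤ _ := by norm_num

/-- The estimate needed where `R - 1 < -Re z`, in terms of the bound `Y` for `|Im z|` with
`R = (1 + Y²) / 2`. -/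
theorem poly_mul_exp_le {Y : ℝ} (hY : 1 ≤ Y) :
    (1 + Y ^ 2) ^ 2 / 2 * (9 / 4 * (Real.exp (Real.pi * Y) / (2 * (Real.pi * Y)))) ≤
      Real.exp (Real.pi * ((1 + Y ^ 2) / 2)) := by
  have hπ := Real.pi_gt_d2
  obtain ⟨u, rfl⟩ : ∃ u, Y = 1 + u := ⟨Y - 1, by ring⟩
  have hu : 0 ≤ u := by linarith
  -- The quotient of the two exponentials is `exp (π (Y - 1) ^ 2 / 2)`; its quadratic Taylor
  -- polynomial suffices.
  have hexp : 1 + 1.57 * u ^ 2 + (1.57 * u ^ 2) ^ 2 / 2 ≤ Real.exp (Real.pi * (u ^ 2 / 2)) := by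
    refine (Real.quadratic_le_exp_of_nonneg (by positivity)).trans (Real.exp_le_exp.2 ?_)
    nlinarith [sq_nonneg u]
  rw [show Real.pi * ((1 + (1 + u) ^ 2) / 2) = Real.pi * (1 + u) + Real.pi * (u ^ 2 / 2) by ring,
    Real.exp_add]
  have hpoly : 9 * (1 + (1 + u) ^ 2) ^ 2 ≤
      16 * 3.14 * (1 + u) * (1 + 1.57 * u ^ 2 + (1.57 * u ^ 2) ^ 2 / 2) := by
    nlinarith [mul_nonneg hu (sq_nonneg (u - 1 / 3)), mul_nonneg hu (sq_nonneg (u ^ 2 - 1 / 9)),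
      sq_nonneg (u - 1 / 3), mul_nonneg hu (sq_nonneg (u ^ 2 - u / 3)), sq_nonneg (u ^ 2 - u / 3),
      sq_nonneg (u ^ 2 - 1 / 9)]
  have h2 : 9 * (1 + (1 + u) ^ 2) ^ 2 ≤
      16 * Real.pi * (1 + u) * Real.exp (Real.pi * (u ^ 2 / 2)) := by
    refine hpoly.trans ?_
    gcongr
  calc _ = Real.exp (Real.pi * (1 + u)) *
        (9 * (1 + (1 + u) ^ 2) ^ 2 / (16 * Real.pi * (1 + u))) := by
        field_simp; ring
    _ ≤ _ := by
        gcongr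
        rw [div_le_iff₀ (by positivity)]
        linarith

theorem normSq_inv_Gamma_one_add_le_of_one_le_norm {z : ℂ} (hz : 1 ≤ ‖z‖) :
    ‖(Complex.Gamma (1 + z))⁻¹‖ ^ 2 ≤
      Real.exp (Real.pi * ‖z‖) * ‖z‖ ^ (2 * ‖z‖ - 1) := by
  have hπ := Real.pi_gt_d2
  set R := ‖z‖ with hR
  have hR0 : 0 < R := by linarith
  have hpow : 1 ≤ R ^ (2 * R - 1) := Real.one_le_rpow hz (by linarith)
  have him : |z.im| ≤ R := Complex.abs_im_le_norm z
  rcases le_or_gt 0 z.re with hx | hx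
  · refine (normSq_inv_Gamma_one_add_le hx hR0 him (by norm_num)
      (two_thirds_le_Gamma_one_add hx)).trans ?_
    calc _ = Real.exp (Real.pi * R) * (9 / (8 * (Real.pi * R))) := by ring
      _ ≤ Real.exp (Real.pi * R) * 1 := by
          gcongr
          rw [div_le_one (by positivity)]
          nlinarith
      _ ≤ _ := by gcongr
  obtain ⟨j, hj, hj1, hshift⟩ := exists_shift_of_re_neg hx
  have hsq : z.re ^ 2 + z.im ^ 2 = R ^ 2 := by
    rw [hR, ← Complex.normSq_eq_norm_sq, Complex.normSq_apply]
    ring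
  have ht : (z.re + j + 1) ^ 2 ≤ 1 := by nlinarith
  have hRj : (R ^ 2) ^ j ≤ R ^ (2 * -z.re) := by
    rw [← pow_mul, ← Real.rpow_natCast]
    push_cast
    exact Real.rpow_le_rpow_of_exponent_le hz (by linarith)
  have key : ∀ Y : ℝ, 0 < Y → |z.im| ≤ Y → ‖(Complex.Gamma (1 + z))⁻¹‖ ^ 2 ≤
      R ^ (2 * -z.re) * (1 + Y ^ 2) *
        (9 / 4 * (Real.exp (Real.pi * Y) / (2 * (Real.pi * Y)))) := by
    intro Y hY hyY
    refine (normSq_inv_Gamma_one_add_le_of_shift hj1 hshift hY hyY (by norm_num)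
      (two_thirds_le_Gamma_one_add hj1)).trans ?_
    have : z.im ^ 2 ≤ Y ^ 2 := sq_le_sq' (abs_le.1 hyY).1 (abs_le.1 hyY).2
    rw [show (((2 : ℝ) / 3) ^ 2)⁻¹ = 9 / 4 by norm_num]
    gcongr
  -- Away from the negative real axis the smaller power of `R` absorbs the last factor. Near it,
  -- `z.im ^ 2 = R ^ 2 - z.re ^ 2 ≤ 2 * R - 1` makes the exponential in `z.im` small instead.
  rcases le_or_gt (-z.re) (R - 1) with hs | hs
  · refine (key R hR0 him).trans ?_
    have h1 : R ^ (2 * -z.re) * R ≤ R ^ (2 * R - 1) := by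
      rw [← Real.rpow_add_one hR0.ne']
      exact Real.rpow_le_rpow_of_exponent_le hz (by linarith)
    calc _ = Real.exp (Real.pi * R) * (R ^ (2 * -z.re) * R) *
          (9 * (1 + R ^ 2) / (8 * Real.pi * R ^ 2)) := by field_simp; ring
      _ ≤ Real.exp (Real.pi * R) * R ^ (2 * R - 1) * 1 := by
          gcongr
          rw [div_le_one (by positivity)]
          nlinarith
      _ = _ := mul_one _
  · have hY1 : 1 ≤ √(2 * R - 1) := Real.one_le_sqrt.2 (by linarith)
    have hYsq : √(2 * R - 1) ^ 2 = 2 * R - 1 := Real.sq_sqrt (by linarith)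
    have hyY : |z.im| ≤ √(2 * R - 1) := by
      apply Real.abs_le_sqrt
      nlinarith
    refine (key _ (by linarith) hyY).trans ?_
    have h1 : R ^ (2 * -z.re) ≤ R ^ (2 * R - 1) * R := by
      rw [← Real.rpow_add_one hR0.ne']
      refine Real.rpow_le_rpow_of_exponent_le hz ?_
      have := (abs_le.1 (Complex.abs_re_le_norm z)).1
      linarith
    have h2 := poly_mul_exp_le hY1
    rw [hYsq, show (1 + (2 * R - 1)) / 2 = R by ring] at h2
    rw [hYsq]
    calc _ ≤ R ^ (2 * R - 1) * R * (1 + (2 * R - 1)) * (9 / 4 *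
          (Real.exp (Real.pi * √(2 * R - 1)) / (2 * (Real.pi * √(2 * R - 1))))) := by
          gcongr
          linarith
      _ = R ^ (2 * R - 1) * ((1 + (2 * R - 1)) ^ 2 / 2 * (9 / 4 *
          (Real.exp (Real.pi * √(2 * R - 1)) / (2 * (Real.pi * √(2 * R - 1)))))) := by ring
      _ ≤ R ^ (2 * R - 1) * Real.exp (Real.pi * R) := by gcongr
      _ = _ := mul_comm _ _

/-! ### The coefficient bound -/

/-- Cauchy's estimate for `1 / Γ(z) = z / Γ(1 + z)`. -/
theorem norm_rgammaCoeff_le_of_sphere {n : ℕ} {R C : ℝ} (hR : 0 < R)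
    (hC : ∀ z : ℂ, ‖z‖ = R → ‖(Complex.Gamma (1 + z))⁻¹‖ ≤ C) :
    ‖rgammaCoeff n‖ ≤ R * C / R ^ n := by
  have h := Complex.norm_iteratedDeriv_le_of_forall_mem_sphere_norm_le n hR
    (f := fun z : ℂ => (Complex.Gamma z)⁻¹) (c := 0) (C := R * C)
    Complex.differentiable_one_div_Gamma.diffContOnCl (fun z hz => by
      have hz' : ‖z‖ = R := by simpa using hz
      rw [Complex.one_div_Gamma_eq_self_mul_one_div_Gamma_add_one, norm_mul, hz', add_comm z]
      gcongr
      exact hC z hz')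
  have hn : (0 : ℝ) < n.factorial := by exact_mod_cast n.factorial_pos
  rw [rgammaCoeff, norm_div, Complex.norm_natCast, div_le_iff₀ hn]
  exact h.trans_eq (by ring)

theorem rgammaCoeff_zero : rgammaCoeff 0 = 0 := by
  simp [rgammaCoeff, Complex.Gamma_zero]

theorem rgammaCoeff_one : rgammaCoeff 1 = 1 := by
  have hfun : (fun z : ℂ => (Complex.Gamma z)⁻¹) = fun z => z * (Complex.Gamma (z + 1))⁻¹ :=
    funext Complex.one_div_Gamma_eq_self_mul_one_div_Gamma_add_one
  have hd : DifferentiableAt ℂ (fun z : ℂ => (Complex.Gamma (z + 1))⁻¹) 0 :=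
    (Complex.differentiable_one_div_Gamma.comp (differentiable_id.add_const 1)).differentiableAt
  have h := (hasDerivAt_id (0 : ℂ)).mul hd.hasDerivAt
  have h' : deriv (fun z => z * (Complex.Gamma (z + 1))⁻¹) (0 : ℂ) = _ := h.deriv
  rw [rgammaCoeff, iteratedDeriv_one, hfun, h']
  simp

theorem coeffBound_eq_exp {n : ℕ} {R : ℝ} (hR : 0 < R) :
    coeffBound n R = Real.exp (Real.pi * R / 2 + (1 / 2 + R - n) * Real.log R) := by
  rw [coeffBound, Real.rpow_def_of_pos hR, Real.exp_add, mul_comm (Real.log R)]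

/-- The convex function `R log R` lies above its tangent line at `p`. -/
theorem tangent_le_mul_log {p R : ℝ} (hp : 0 < p) (hR : 0 < R) :
    R * Real.log p + R - p ≤ R * Real.log R := by
  have h := Real.log_le_sub_one_of_pos (div_pos hp hR)
  rw [Real.log_div hp.ne' hR.ne'] at h
  have h2 := mul_le_mul_of_nonneg_left h hR.le
  rw [mul_sub, mul_sub, mul_div_cancel₀ _ hR.ne'] at h2
  linarith

theorem norm_rgammaCoeff_le_coeffBound_of_one_le {n : ℕ} {R : ℝ} (hR : 1 ≤ R) :
    ‖rgammaCoeff n‖ ≤ coeffBound n R := by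
  have hR0 : 0 < R := by linarith
  refine (norm_rgammaCoeff_le_of_sphere hR0
    (C := Real.exp (Real.pi * R / 2) * R ^ (R - 1 / 2)) fun z hz => ?_).trans_eq ?_
  · rw [← sq_le_sq₀ (norm_nonneg _) (by positivity)]
    refine (normSq_inv_Gamma_one_add_le_of_one_le_norm (hz ▸ hR)).trans_eq ?_
    rw [hz, mul_pow, ← Real.exp_nat_mul, ← Real.rpow_mul_natCast hR0.le]
    push_cast
    ring_nf
  · rw [coeffBound, show (1 : ℝ) / 2 + R - n = (R - 1 / 2) + 1 - n by ring,
      Real.rpow_sub hR0 (R - 1 / 2 + 1), Real.rpow_add_one hR0.ne', Real.rpow_natCast]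
    ring

theorem one_le_coeffBound_one {R : ℝ} (hR : 0 < R) (hR1 : R ≤ 1) : 1 ≤ coeffBound 1 R := by
  rw [coeffBound_eq_exp hR, Real.one_le_exp_iff]
  have hlog : -Real.log R * (1 / 2 - R) ≥ -(R / 2) := by
    have h1 := tangent_le_mul_log one_pos hR
    have h2 := Real.log_le_sub_one_of_pos hR
    simp only [Real.log_one] at h1
    nlinarith
  push_cast
  nlinarith [Real.pi_gt_d2]

/-- The worst case is `n = 2`. Tangent lines at `7 / 10`, close to the minimum point of the bound,
show that its logarithm is at least `5 / 4`. -/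
theorem le_coeffBound_of_le_one {n : ℕ} {R : ℝ} (hn : 2 ≤ n) (hR : 0 < R) (hR1 : R ≤ 1) :
    3.38 ≤ coeffBound n R := by
  have hlogp : Real.log (7 / 10) ≤ 7 / 10 - 1 := Real.log_le_sub_one_of_pos (by norm_num)
  have h1 := tangent_le_mul_log (p := 7 / 10) (by norm_num) hR
  have h2 : Real.log R ≤ Real.log (7 / 10) + R / (7 / 10) - 1 := by
    have h := Real.log_le_sub_one_of_pos (show 0 < R / (7 / 10) by positivity)
    rw [Real.log_div hR.ne' (by norm_num)] at h
    linarith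
  have hlog : Real.log R ≤ 0 := Real.log_nonpos hR.le hR1
  have hn' : (2 : ℝ) ≤ n := by exact_mod_cast hn
  have hE : (1 : ℝ) + 1 / 4 ≤ Real.pi * R / 2 + (1 / 2 + R - n) * Real.log R := by
    have h3 : (1 / 2 + R - 2) * Real.log R ≤ (1 / 2 + R - n) * Real.log R :=
      mul_le_mul_of_nonpos_right (by linarith) hlog
    have h4 := Real.pi_gt_d2
    nlinarith
  rw [coeffBound_eq_exp hR]
  refine le_trans ?_ (Real.exp_le_exp.2 hE)
  rw [Real.exp_add]
  have h5 := Real.exp_one_gt_d9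
  have h6 := Real.add_one_le_exp (1 / 4 : ℝ)
  nlinarith

theorem norm_rgammaCoeff_le_coeffBound (n : ℕ) {R : ℝ} (hR : 0 < R) :
    ‖rgammaCoeff n‖ ≤ coeffBound n R := by
  rcases le_total 1 R with h1 | h1
  · exact norm_rgammaCoeff_le_coeffBound_of_one_le h1
  rcases n with _ | _ | n
  · rw [rgammaCoeff_zero, norm_zero, coeffBound_eq_exp hR]
    positivity
  · rw [zero_add, rgammaCoeff_one, norm_one]
    exact one_le_coeffBound_one hR h1
  · refine le_trans ?_ (le_coeffBound_of_le_one (by omega) hR h1)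
    refine (norm_rgammaCoeff_le_of_sphere one_pos (C := 3.38) fun z hz => ?_).trans_eq (by simp)
    rw [← sq_le_sq₀ (norm_nonneg _) (by norm_num)]
    exact (normSq_inv_Gamma_one_add_le_of_norm_eq_one hz).trans (by norm_num)

/-! ### The optimal radius -/

theorem lambertW0_pos {x : ℝ} (hx : 0 < x) : 0 < lambertW0 x := by
  have h := (lambertW0_spec (x := x) (by linarith [Real.exp_pos (-1)])).2
  exact pos_of_mul_pos_left (h ▸ hx) (Real.exp_pos _).le

/-- The logarithm of `coeffBound n` is strictly convex, and `optimalRadius n` is its critical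
point. -/
theorem coeffBound_optimalRadius_lt {n : ℕ} (hn : 1 ≤ n) (hp : 0 < optimalRadius n) {R : ℝ}
    (hR : 0 < R) (hne : R ≠ optimalRadius n) :
    coeffBound n (optimalRadius n) < coeffBound n R := by
  have hn' : (1 : ℝ) ≤ n := by exact_mod_cast hn
  -- The logarithm of `w * exp w = x`, where `w = (n - 1 / 2) / optimalRadius n`.
  have hcrit : Real.log (optimalRadius n) + Real.pi / 2 + 1 =
      ((n : ℝ) - 1 / 2) / optimalRadius n := by
    have hν : 0 < (n : ℝ) - 1 / 2 := by linarith
    have hx : 0 < ((n : ℝ) - 1 / 2) * Real.exp (Real.pi / 2 + 1) := by positivity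
    have hw := lambertW0_pos hx
    have hlog := congrArg Real.log
      (lambertW0_spec (by linarith [Real.exp_pos (-1)] :
        -Real.exp (-1) ≤ ((n : ℝ) - 1 / 2) * Real.exp (Real.pi / 2 + 1))).2
    rw [Real.log_mul hw.ne' (Real.exp_ne_zero _), Real.log_mul hν.ne' (Real.exp_ne_zero _),
      Real.log_exp, Real.log_exp] at hlog
    rw [optimalRadius, Real.log_div hν.ne' hw.ne', div_div_cancel₀ hν.ne']
    linarith
  generalize optimalRadius n = p at *
  rw [coeffBound_eq_exp hp, coeffBound_eq_exp hR, Real.exp_lt_exp]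
  have h1 := tangent_le_mul_log hp hR
  have h2 : Real.log R < Real.log p + R / p - 1 := by
    have h := Real.log_lt_sub_one_of_pos (div_pos hR hp) (by rwa [Ne, div_eq_one_iff_eq hp.ne'])
    rw [Real.log_div hR.ne' hp.ne'] at h
    linarith
  have h3 : ((n : ℝ) - 1 / 2) * Real.log R < ((n : ℝ) - 1 / 2) * (Real.log p + R / p - 1) :=
    mul_lt_mul_of_pos_left h2 (by linarith)
  have h4 : R * (Real.log p + Real.pi / 2 + 1) = ((n : ℝ) - 1 / 2) * (R / p) := by
    rw [hcrit]; ring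
  have h5 : p * (Real.log p + Real.pi / 2 + 1) = (n : ℝ) - 1 / 2 := by
    rw [hcrit]; field_simp
  linarith

theorem theorem4p2 :
    (∀ (n : ℕ) (R : ℝ), 0 < R → ‖rgammaCoeff n‖ ≤ coeffBound n R) ∧
    (∀ n : ℕ, 1 ≤ n →
      0 < shiftedRadius n ∧ ‖rgammaCoeff n‖ ≤ coeffBound n (shiftedRadius n)) ∧
    (∀ n : ℕ, 1 ≤ n →
      0 < optimalRadius n ∧ ‖rgammaCoeff n‖ ≤ coeffBound n (optimalRadius n) ∧
      ∀ R : ℝ, 0 < R → R ≠ optimalRadius n →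
        coeffBound n (optimalRadius n) < coeffBound n R) := by
  refine ⟨fun n R hR => norm_rgammaCoeff_le_coeffBound n hR, fun n hn => ?_, fun n hn => ?_⟩
  · have hn' : (1 : ℝ) ≤ n := by exact_mod_cast hn
    have hpos : 0 < shiftedRadius n :=
      div_pos (by linarith) (lambertW0_pos (mul_pos (by linarith) (Real.exp_pos _)))
    exact ⟨hpos, norm_rgammaCoeff_le_coeffBound n hpos⟩
  · have hn' : (1 : ℝ) ≤ n := by exact_mod_cast hn
    have hpos : 0 < optimalRadius n :=
      div_pos (by linarith) (lambertW0_pos (mul_pos (by linarith) (Real.exp_pos _)))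
    exact ⟨hpos, norm_rgammaCoeff_le_coeffBound n hpos,
      fun R hR hne => coeffBound_optimalRadius_lt hn hpos hR hne⟩
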